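/- Let $M$ be a von Neumann algebra acting on a complex Hilbert space, let $\mathbb{G}=\mathbb{N}_0$ or $\mathbb{G}=\mathbb{R}_+=[0,\infty)$, and let $(\Phi_g)_{g\in\mathbb{G}}$ be a semigroup ($\Phi_{g+h}=\Phi_g\circ\Phi_h$) of linear normal positive unital maps on $M$. No continuity in $g$ is assumed, nor is $\Phi_0=\mathrm{id}$. Let $\omega$ be a faithful normal state on $M$ with $\omega\circ\Phi_g=\omega$ for all $g\in\mathbb{G}$. For $\lambda\in\mathbb{C}$ with $|\lambda|=1$ put $$M_\lambda=\{x\in M:\ \Phi_g(x)=\lambda^g x\ \text{ for all } g\in\mathbb{G}\};$$ here, when $\mathbb{G}=\mathbb{R}_+$, one fixes any $\theta\in\mathbb{R}$ with $\lambda=e^{i\theta}$ and puts $\lambda^t=e^{i\theta t}$ (for $\theta=\arg\lambda$ this is the principal power). Assume that the semigroup is ergodic, i.e. that its fixed-point space $\{x\in M:\ \Phi_g(x)=x \text{ for all } g\in\mathbb{G}\}$ equals $\mathbb{C}\mathbf{1}$. Let $x\in M_\lambda$, $x\neq 0$, be an eigenvector. Write $e^\perp=\mathbf{1}-e$ for a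 projection $e$. Then at least one of the following holds: (i) $x=\alpha v$, where $\alpha\in\mathbb{C}$ and $v\in M_\lambda$ is a partial isometry such that $v^*v=e$ and $vv^*=e^\perp$ for some projection $e\in M$ with $e\neq 0$, $e\neq\mathbf{1}$; (ii) $x=\alpha_1v_1+\alpha_2v_2$, where $\alpha_1,\alpha_2$ are nonzero complex numbers, $\alpha_1\neq\alpha_2$, and $v_1,v_2\in M_\lambda$ are partial isometries such that, for some projection $e\in M$ with $e\neq 0$, $e\neq\mathbf{1}$, $$v_1^*v_1=e,\qquad v_1v_1^*=e^\perp,\qquad v_2^*v_2=e^\perp,\qquad v_2v_2^*=e;$$ (iii) $x=\alpha u$, where $\alpha\in\mathbb{C}$ and $u\in M_\lambda$ is unitary. -/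

import Mathlib

open scoped NNReal ComplexOrder

/-- A positive linear map between ordered star-algebras is normal if it preserves suprema of
increasing nets of self-adjoint elements: whenever a nonempty upward directed set `d` of
self-adjoint elements has a supremum `a`, the image of `d` has the supremum `f a`.
For positive maps between von Neumann algebras (and for positive functionals, the target being
`ℂ`) this is the usual definition of normality. -/
def IsNormalMap {A B : Type*} [Star A] [Preorder A] [Preorder B] (f : A → B) : Prop :=
  ∀ d : Set A, d.Nonempty → (∀ a ∈ d, IsSelfAdjoint a) → DirectedOn (· ≤ ·) d →
    ∀ a : A, IsLUB d a → IsLUB (f '' d) (f a)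

section StarAlgebra

variable {A : Type*} [Ring A] [StarRing A] [Algebra ℂ A] [PartialOrder A]

/-- A faithful normal state: a positive linear functional `ω` with `ω 1 = 1` which is normal and
vanishes at no nonzero positive element. -/
structure IsFaithfulNormalState (ω : A →ₚ[ℂ] ℂ) : Prop where
  map_one : ω 1 = 1
  normal : IsNormalMap ω
  faithful : ∀ x : A, 0 ≤ x → ω x = 0 → x = 0

/-- `Φ` is a semigroup, indexed by the additive monoid `G`, of normal positive unital linear maps.
`Φ 0` need not be the identity. -/
structure IsNormalUnitalSemigroup {G : Type*} [AddMonoid G] (Φ : G → (A →ₚ[ℂ] A)) : Prop where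
  map_add : ∀ g h : G, ∀ x : A, Φ (g + h) x = Φ g (Φ h x)
  map_one : ∀ g : G, Φ g 1 = 1
  normal : ∀ g : G, IsNormalMap (Φ g)

/-- The functional `ω` is invariant under all the maps `Φ g`. -/
def IsInvariantUnder {G : Type*} (ω : A →ₚ[ℂ] ℂ) (Φ : G → (A →ₚ[ℂ] A)) : Prop :=
  ∀ g : G, ∀ x : A, ω (Φ g x) = ω x

/-- The space of all `x` with `Φ g x = χ g • x` for every `g`. For `χ g = lam ^ g` this is the
eigenspace `M_lam`. -/
def semigroupEigenspace {G : Type*} (Φ : G → (A →ₚ[ℂ] A)) (χ : G → ℂ) : Submodule ℂ A where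
  carrier := {x | ∀ g : G, Φ g x = χ g • x}
  add_mem' := by
    intro x y hx hy g
    rw [map_add, hx g, hy g, smul_add]
  zero_mem' := by
    intro g
    rw [map_zero, smul_zero]
  smul_mem' := by
    intro c x hx g
    rw [map_smul, hx g, smul_comm]

/-- The semigroup is ergodic if its fixed-point space `M_1` consists of the multiples of `1`. -/
def IsErgodicSemigroup {G : Type*} (Φ : G → (A →ₚ[ℂ] A)) : Prop :=
  ∀ x : A, x ∈ semigroupEigenspace Φ (fun _ => 1) ↔ ∃ c : ℂ, x = c • (1 : A)

/-- `v` is a partial isometry: `v* v` is a projection. -/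
def IsPartialIsometry (v : A) : Prop := IsStarProjection (star v * v)

/-- A projection different from `0` and `1`. -/
def IsNontrivialProjection (e : A) : Prop := IsStarProjection e ∧ e ≠ 0 ∧ e ≠ 1

/-- `x` is a multiple of a partial isometry `v ∈ E` with `v* v = e`, `v v* = 1 - e`,
for some nontrivial projection `e`. -/
def IsPartialIsometryForm (E : Submodule ℂ A) (x : A) : Prop :=
  ∃ (α : ℂ) (v e : A), v ∈ E ∧ IsPartialIsometry v ∧ IsNontrivialProjection e ∧
    star v * v = e ∧ v * star v = 1 - e ∧ x = α • v

/-- `x = α₁ v₁ + α₂ v₂` with nonzero `α₁ ≠ α₂` and partial isometries `v₁, v₂ ∈ E`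
such that, for some nontrivial projection `e`, `v₁* v₁ = e`, `v₁ v₁* = 1 - e`,
`v₂* v₂ = 1 - e`, `v₂ v₂* = e`. -/
def IsTwoPartialIsometriesForm (E : Submodule ℂ A) (x : A) : Prop :=
  ∃ (α₁ α₂ : ℂ) (v₁ v₂ e : A), α₁ ≠ 0 ∧ α₂ ≠ 0 ∧ α₁ ≠ α₂ ∧ v₁ ∈ E ∧ v₂ ∈ E ∧
    IsPartialIsometry v₁ ∧ IsPartialIsometry v₂ ∧ IsNontrivialProjection e ∧
    star v₁ * v₁ = e ∧ v₁ * star v₁ = 1 - e ∧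
    star v₂ * v₂ = 1 - e ∧ v₂ * star v₂ = e ∧
    x = α₁ • v₁ + α₂ • v₂

/-- `x` is a multiple of a unitary `u ∈ E`. -/
def IsUnitaryForm (E : Submodule ℂ A) (x : A) : Prop :=
  ∃ (α : ℂ) (u : A), u ∈ E ∧ u ∈ unitary A ∧ x = α • u

end StarAlgebra

/-- The function `t ↦ lam ^ t = exp (i θ t)` on the nonnegative reals, where `lam = exp (i θ)`.
The real number `θ` fixes the branch of the power; `θ = arg lam` is the principal one. -/
noncomputable def unimodularPower (θ : ℝ) (t : ℝ≥0) : ℂ :=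
  Complex.exp (Complex.I * (θ : ℂ) * ((t : ℝ) : ℂ))

/-! ### Kadison's inequality and its equality case. -/

namespace PositiveLinearMap

open scoped ComplexStarModule
open Polynomial Filter Topology

variable {A B : Type*} [CStarAlgebra A] [PartialOrder A] [StarOrderedRing A]
  [CStarAlgebra B] [PartialOrder B] [StarOrderedRing B]

/-! For an eigenvector x, Kadison's inequality makes Φ_g(x*x + xx*) − (x*x + xx*) positive; the
invariant faithful state kills it, so x*x + xx* is fixed, hence a scalar t by ergodicity. Equality
in Kadison's inequality places x in the Jordan multiplicative domain
(`map_mul_add_mul_of_map_star_mul_add`). So x² is an eigenvector for the squared character, and the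
same argument gives a scalar d for x². Substituting xx* = t − x*x turns the second scalar into a
quadratic equation for x*x: h = x*x − t/2 has h² = t²/4 − d/2. Also x anticommutes with h, so x
exchanges the spectral projections e and 1 − e of h, and cutting x by them gives the partial
isometries (`trichotomy_of_sq_eq`). They stay in the eigenspace because xx*x is a Jordan expression
in x and x*. -/

theorem aeval_bernsteinPolynomial_nonneg {a : A} (h0 : 0 ≤ a) (h1 : a ≤ 1) (n k : ℕ) :
    0 ≤ aeval a (bernsteinPolynomial ℂ n k) := by
  have hc : Commute (a ^ k) ((1 - a) ^ (n - k)) :=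
    ((Commute.one_right a).sub_right (Commute.refl a)).pow_pow _ _
  have h := hc.mul_nonneg (CStarAlgebra.pow_nonneg h0 k)
    (CStarAlgebra.pow_nonneg (sub_nonneg.2 h1) (n - k))
  have h2 : aeval a (bernsteinPolynomial ℂ n k) =
      (n.choose k) • (a ^ k * (1 - a) ^ (n - k)) := by
    simp [bernsteinPolynomial, mul_assoc]
  rw [h2]
  exact nsmul_nonneg h _

/-- The `n`-th Bernstein approximation of Kadison's inequality. -/
theorem sq_smul_mul_self_le (f : A →ₚ[ℂ] B) (hf : f 1 = 1) {a : A} (h0 : 0 ≤ a) (h1 : a ≤ 1)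
    (n : ℕ) : 0 ≤ ((n : ℂ) ^ 2) • (f (a * a) - f a * f a) + (n : ℂ) • (f a - f (a * a)) := by
  set P : ℕ → B := fun k => f (aeval a (bernsteinPolynomial ℂ n k)) with hP
  have hT : star (f a) = f a := by rw [← map_star, (IsSelfAdjoint.of_nonneg h0).star_eq]
  have hpos : ∀ k, 0 ≤ P k := fun k =>
    f.map_nonneg (aeval_bernsteinPolynomial_nonneg h0 h1 n k)
  have e0 : ∑ k ∈ Finset.range (n + 1), P k = 1 := by
    have := congrArg (fun p => f (aeval a p)) (bernsteinPolynomial.sum ℂ n)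
    simpa [hf] using this
  have e1 : ∑ k ∈ Finset.range (n + 1), (k : ℂ) • P k = (n : ℂ) • f a := by
    have := congrArg (fun p => f (aeval a p)) (bernsteinPolynomial.sum_smul ℂ n)
    simpa only [map_sum, map_smul, aeval_X, ← Nat.cast_smul_eq_nsmul ℂ] using this
  have e2 : ∑ k ∈ Finset.range (n + 1), ((k : ℂ) * (k - 1)) • P k =
      ((n : ℂ) * (n - 1)) • f (a * a) := by
    have := congrArg (fun p => f (aeval a p)) (bernsteinPolynomial.sum_mul_smul ℂ n)
    simp only [map_sum, ← Nat.cast_smul_eq_nsmul ℂ] at this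
    have hk : ∀ k : ℕ, ((k * (k - 1) : ℕ) : ℂ) = (k : ℂ) * (k - 1) := by
      rintro (_ | k) <;> simp
    simpa only [hk, map_smul, map_mul, aeval_X, sq] using this
  -- The P k act as positive binomial weights with total mass 1 and mean n f(a). The sum is their
  -- operator variance; the excess n f(a − a²) is the binomial variance, negligible after division
  -- by n².
  have key : ∑ k ∈ Finset.range (n + 1),
      star ((n : ℂ) • f a - (k : ℂ) • 1) * P k * ((n : ℂ) • f a - (k : ℂ) • 1) =
      ((n : ℂ) ^ 2) • (f (a * a) - f a * f a) + (n : ℂ) • (f a - f (a * a)) := by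
    have hterm : ∀ k : ℕ,
        star ((n : ℂ) • f a - (k : ℂ) • 1) * P k * ((n : ℂ) • f a - (k : ℂ) • 1) =
        ((n : ℂ) ^ 2) • (f a * P k * f a) - (n : ℂ) • (f a * ((k : ℂ) • P k))
          - (n : ℂ) • (((k : ℂ) • P k) * f a) + ((k : ℂ) * (k - 1)) • P k + (k : ℂ) • P k := by
      intro k
      simp only [star_sub, star_smul, star_one, hT, RCLike.star_def, Complex.conj_natCast]
      simp only [sub_mul, mul_sub, smul_mul_assoc, mul_smul_comm, one_mul, mul_one]
      module
    simp only [hterm, Finset.sum_add_distrib, Finset.sum_sub_distrib, ← Finset.smul_sum,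
      ← Finset.mul_sum, ← Finset.sum_mul, e0, e1, e2]
    simp only [smul_mul_assoc, mul_smul_comm, mul_one]
    module
  rw [← key]
  exact Finset.sum_nonneg fun k _ => star_left_conjugate_nonneg (hpos k) _

theorem nonneg_of_forall_nonneg_add_nsmul {d s : B}
    (h : ∀ n : ℕ, 0 ≤ d + (n : ℝ) • s) : 0 ≤ s := by
  have hlim : Tendsto (fun n : ℕ => ((n : ℝ) + 1)⁻¹ • d + s) atTop (𝓝 s) := by
    have h1 : Tendsto (fun n : ℕ => ((n : ℝ) + 1)⁻¹) atTop (𝓝 0) := by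
      simpa using tendsto_one_div_add_atTop_nhds_zero_nat (𝕜 := ℝ)
    simpa using (h1.smul_const d).add_const s
  refine ge_of_tendsto' hlim fun n => ?_
  have hn : (0 : ℝ) < (n : ℝ) + 1 := by positivity
  have := smul_nonneg (inv_nonneg.2 hn.le) (h (n + 1))
  push_cast at this
  rwa [smul_add, smul_smul, inv_mul_cancel₀ hn.ne', one_smul] at this

theorem eq_zero_of_forall_nonneg_add_smul {d s : B} (h : ∀ t : ℝ, 0 ≤ d + t • s) : s = 0 := by
  refine le_antisymm ?_ (nonneg_of_forall_nonneg_add_nsmul fun n => h n)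
  have : 0 ≤ -s := nonneg_of_forall_nonneg_add_nsmul (d := d) fun n => by
    simpa using h (-n)
  simpa using this

theorem map_mul_self_le_of_mem_Icc (f : A →ₚ[ℂ] B) (hf : f 1 = 1) {a : A}
    (h0 : 0 ≤ a) (h1 : a ≤ 1) : f a * f a ≤ f (a * a) := by
  rw [← sub_nonneg]
  refine nonneg_of_forall_nonneg_add_nsmul (d := f a - f (a * a)) fun n => ?_
  -- Dividing the Bernstein estimate by n needs n > 0; at n = 0 the claim is only f(a(1 − a)) ≥ 0.
  rcases Nat.eq_zero_or_pos n with rfl | hn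
  · have hc : Commute a (1 - a) := (Commute.one_right a).sub_right (Commute.refl a)
    have := f.map_nonneg (hc.mul_nonneg h0 (sub_nonneg.2 h1))
    rw [mul_sub, mul_one, map_sub] at this
    simpa only [Nat.cast_zero, zero_smul, add_zero] using this
  · have hn' : (0 : ℝ) < n := by exact_mod_cast hn
    have := smul_nonneg (inv_nonneg.2 hn'.le) (sq_smul_mul_self_le f hf h0 h1 n)
    convert this using 1
    have e : ∀ b : B, (n : ℂ) • b = (n : ℝ) • b := fun b => by
      rw [Nat.cast_smul_eq_nsmul, Nat.cast_smul_eq_nsmul]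
    rw [sq, mul_smul, e, e, e]
    match_scalars <;> field_simp
    ring

/-- **Kadison's inequality** for a positive unital map and a self-adjoint element. -/
theorem map_mul_self_le (f : A →ₚ[ℂ] B) (hf : f 1 = 1) {a : A} (ha : IsSelfAdjoint a) :
    f a * f a ≤ f (a * a) := by
  set r : ℝ := ‖a‖ + 1 with hr
  have hr0 : 0 < r := by positivity
  have hrc : (r : ℂ) ≠ 0 := by exact_mod_cast hr0.ne'
  have hle : a ≤ r • (1 : A) := by
    refine (IsSelfAdjoint.le_algebraMap_norm_self ha).trans ?_
    rw [Algebra.algebraMap_eq_smul_one]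
    exact smul_le_smul_of_nonneg_right (by simp [hr]) zero_le_one
  have hge : -(r • (1 : A)) ≤ a := by
    refine le_trans (neg_le_neg ?_) (IsSelfAdjoint.neg_algebraMap_norm_le_self ha)
    rw [Algebra.algebraMap_eq_smul_one]
    exact smul_le_smul_of_nonneg_right (by simp [hr]) zero_le_one
  have hr2 : (0 : ℝ) ≤ (2 * r)⁻¹ := by positivity
  -- Affine rescaling into [0, 1]: the defect f(a²) − f(a)² ignores scalar shifts and scales
  -- quadratically. The 1 added in r keeps it positive when a = 0.
  set b : A := (2 * r)⁻¹ • (a + r • 1) with hb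
  have hb0 : 0 ≤ b := smul_nonneg hr2 (by simpa [add_comm] using sub_nonneg.2 hge)
  have hb1 : b ≤ 1 := by
    have : (1 : A) = (2 * r)⁻¹ • ((2 * r) • 1) := by
      rw [smul_smul, inv_mul_cancel₀ (by positivity), one_smul]
    rw [this, hb]
    refine smul_le_smul_of_nonneg_left ?_ hr2
    rw [two_mul, add_smul r r]
    exact add_le_add_left hle _
  have hab : a = (2 * r : ℂ) • b - (r : ℂ) • 1 := by
    rw [hb, ← Complex.coe_smul, ← Complex.coe_smul]
    push_cast
    match_scalars <;> field_simp
    ring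
  have hk := map_mul_self_le_of_mem_Icc f hf hb0 hb1
  rw [← sub_nonneg] at hk ⊢
  have := smul_nonneg (show (0 : ℝ) ≤ (2 * r) ^ 2 by positivity) hk
  convert this using 1
  rw [← Complex.coe_smul, hab]
  simp only [sub_mul, mul_sub, smul_mul_assoc, mul_smul_comm, one_mul, mul_one, map_sub, map_smul,
    hf]
  push_cast
  module

/-- Kadison's inequality in its Jordan form, for arbitrary elements. -/
theorem map_star_mul_add_mul_star_le (f : A →ₚ[ℂ] B) (hf : f 1 = 1) (x : A) :
    star (f x) * f x + f x * star (f x) ≤ f (star x * x + x * star x) := by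
  have h1 := map_mul_self_le f hf (ℜ x).2
  have h2 := map_mul_self_le f hf (ℑ x).2
  rw [star_mul_self_add_self_mul_star, star_mul_self_add_self_mul_star, map_nsmul, map_add]
  rw [map_realPart] at h1
  rw [map_imaginaryPart] at h2
  exact nsmul_le_nsmul_right (add_le_add h1 h2) 2

/-- An element at which Kadison's inequality is an equality belongs to the Jordan multiplicative
domain. -/
theorem map_mul_add_mul_of_map_star_mul_add (f : A →ₚ[ℂ] B) (hf : f 1 = 1) {x : A}
    (hx : f (star x * x + x * star x) = star (f x) * f x + f x * star (f x)) (z : A) :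
    f (z * x + x * z) = f z * f x + f x * f z := by
  obtain ⟨y, rfl⟩ : ∃ y, z = star y := ⟨star z, (star_star z).symm⟩
  -- The Kadison defect is a positive sesquilinear form, so D x x = 0 should force D y x = 0, as in
  -- Cauchy–Schwarz. Perturbing y by real and by imaginary multiples of x kills the sum and the
  -- difference of D y x and D x y.
  set D : A → A → B := fun y x => f (star y * x + x * star y) -
    (star (f y) * f x + f x * star (f y)) with hD
  have hxx : D x x = 0 := sub_eq_zero.2 hx
  have hnn : ∀ w, 0 ≤ D w w := fun w => sub_nonneg.2 (map_star_mul_add_mul_star_le f hf w)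
  have hexp : ∀ t : ℂ, D (y + t • x) (y + t • x) =
      D y y + (t • D y x + star t • D x y) := by
    intro t
    have : D (y + t • x) (y + t • x) =
      D y y + (t • D y x + star t • D x y) + (t * star t) • D x x := by
      simp only [hD, star_add, star_smul, map_add, map_smul, add_mul, mul_add, smul_mul_assoc,
        mul_smul_comm]
      module
    rw [this, hxx, smul_zero, add_zero]
  have h1 : D y x + D x y = 0 := by
    refine eq_zero_of_forall_nonneg_add_smul (d := D y y) fun t => ?_
    have := hnn (y + (t : ℂ) • x)
    rwa [hexp, RCLike.star_def, Complex.conj_ofReal, ← smul_add, Complex.coe_smul] at this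
  have h2 : Complex.I • (D y x - D x y) = 0 := by
    refine eq_zero_of_forall_nonneg_add_smul (d := D y y) fun t => ?_
    have := hnn (y + ((t : ℂ) * Complex.I) • x)
    rw [hexp] at this
    convert this using 2
    rw [← Complex.coe_smul]
    simp only [RCLike.star_def, map_mul, Complex.conj_ofReal, Complex.conj_I]
    module
  have h3 : D y x - D x y = 0 := (smul_eq_zero.1 h2).resolve_left Complex.I_ne_zero
  have h4 : (2 : ℂ) • D y x = 0 := by
    have : (2 : ℂ) • D y x = (D y x + D x y) + (D y x - D x y) := by module
    rw [this, h1, h3, add_zero]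
  have h5 := (smul_eq_zero.1 h4).resolve_left two_ne_zero
  rw [map_star]
  exact sub_eq_zero.1 h5

end PositiveLinearMap

/-! ### Splitting an element by the spectral projections of h. -/

section Classification

variable {A : Type*} [CStarAlgebra A]

/-- Cutting `x` by a projection `e` on which `x* x` and `x x*` are the same positive scalar. -/
theorem smul_mul_projection {x e : A} (he : IsStarProjection e) {s : ℝ} (hs : 0 < s)
    (hxe : x * e = (1 - e) * x) (h1 : star x * x * e = (s : ℂ) • e)
    (h2 : (1 - e) * (x * star x) = (s : ℂ) • (1 - e)) :
    star (((Real.sqrt s : ℂ)⁻¹) • (x * e)) * (((Real.sqrt s : ℂ)⁻¹) • (x * e)) = e ∧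
    (((Real.sqrt s : ℂ)⁻¹) • (x * e)) * star (((Real.sqrt s : ℂ)⁻¹) • (x * e)) = 1 - e := by
  have hse : star e = e := he.isSelfAdjoint.star_eq
  have hee : e * e = e := he.isIdempotentElem
  have hsq : (Real.sqrt s : ℂ)⁻¹ * (Real.sqrt s : ℂ)⁻¹ * (s : ℂ) = 1 := by
    rw [← mul_inv, ← Complex.ofReal_mul, Real.mul_self_sqrt hs.le]
    exact inv_mul_cancel₀ (by exact_mod_cast hs.ne')
  have e1 : star (x * e) * (x * e) = (s : ℂ) • e := by
    rw [star_mul, hse, mul_assoc, ← mul_assoc (star x), h1, mul_smul_comm, hee]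
  have e2 : (x * e) * star (x * e) = (s : ℂ) • (1 - e) := by
    rw [star_mul, hse, mul_assoc, ← mul_assoc e, hee, ← mul_assoc, hxe, mul_assoc, h2]
  have hst : star ((Real.sqrt s : ℂ)⁻¹) = (Real.sqrt s : ℂ)⁻¹ := by
    simp [← Complex.ofReal_inv]
  constructor
  · rw [star_smul, hst, smul_mul_smul_comm, e1, smul_smul, hsq, one_smul]
  · rw [star_smul, hst, smul_mul_smul_comm, e2, smul_smul, hsq, one_smul]

/-- The trichotomy for an element `x` with `x* x = m + h` and `x x* = m - h`, where `h² = r²` is a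
scalar and the space `E` contains `x` and `x h`. -/
theorem trichotomy_of_sq_eq {E : Submodule ℂ A} {x h : A} {m r : ℝ} (hx : x ∈ E)
    (hxh : x * h ∈ E) (hx0 : x ≠ 0) (hr : 0 ≤ r) (hrm : r ≤ m)
    (hp : star x * x = (m : ℂ) • 1 + h) (hq : x * star x = (m : ℂ) • 1 - h)
    (hh : h * h = ((r ^ 2 : ℝ) : ℂ) • 1) :
    IsPartialIsometryForm E x ∨ IsTwoPartialIsometriesForm E x ∨ IsUnitaryForm E x := by
  have hsa : star h = h := by
    have : h = star x * x - (m : ℂ) • 1 := by rw [hp]; abel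
    rw [this]
    simp
  -- This is x(x*x) = (xx*)x with both products expressed through h.
  have hanti : x * h = -(h * x) := by
    have h1 : x * ((m : ℂ) • 1 + h) = ((m : ℂ) • 1 - h) * x := by
      rw [← hp, ← hq, mul_assoc]
    simp only [mul_add, sub_mul, smul_mul_assoc, mul_smul_comm, one_mul, mul_one] at h1
    rw [sub_eq_add_neg] at h1
    exact add_left_cancel h1
  have hroot : ∀ s : ℝ, 0 < s → ((Real.sqrt s : ℂ)) ≠ 0 := fun s hs => by
    exact_mod_cast (Real.sqrt_pos.2 hs).ne'
  have hback : ∀ s : ℝ, 0 < s → ∀ y : A,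
      y = (Real.sqrt s : ℂ) • ((Real.sqrt s : ℂ)⁻¹ • y) := fun s hs y => by
    rw [smul_smul, mul_inv_cancel₀ (hroot s hs), one_smul]
  rcases hr.eq_or_lt with rfl | hr0
  · right; right
    have hh0 : h = 0 := by
      have : star h * h = 0 := by rw [hsa, hh]; simp
      exact (CStarRing.star_mul_self_eq_zero_iff h).1 this
    subst hh0
    have hm0 : 0 < m := by
      refine hrm.lt_of_ne fun hm => hx0 ?_
      rw [← CStarRing.star_mul_self_eq_zero_iff, hp, ← hm]
      simp
    have hst : star ((Real.sqrt m : ℂ)⁻¹) = (Real.sqrt m : ℂ)⁻¹ := by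
      simp [← Complex.ofReal_inv]
    have hsq : (Real.sqrt m : ℂ)⁻¹ * (Real.sqrt m : ℂ)⁻¹ * (m : ℂ) = 1 := by
      rw [← mul_inv, ← Complex.ofReal_mul, Real.mul_self_sqrt hm0.le]
      exact inv_mul_cancel₀ (by exact_mod_cast hm0.ne')
    refine ⟨Real.sqrt m, (Real.sqrt m : ℂ)⁻¹ • x, E.smul_mem _ hx, ?_, hback m hm0 x⟩
    rw [Unitary.mem_iff]
    constructor
    · rw [star_smul, hst, smul_mul_smul_comm, hp, add_zero, smul_smul, hsq, one_smul]
    · rw [star_smul, hst, smul_mul_smul_comm, hq, sub_zero, smul_smul, hsq, one_smul]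
  have hrc : (r : ℂ) ≠ 0 := by exact_mod_cast hr0.ne'
  obtain ⟨g, rfl⟩ : ∃ g, h = (r : ℂ) • g := ⟨(r : ℂ)⁻¹ • h, by
    rw [smul_smul, mul_inv_cancel₀ hrc, one_smul]⟩
  have hgs : star g = g := by
    rw [star_smul, RCLike.star_def, Complex.conj_ofReal] at hsa
    exact smul_right_injective A hrc hsa
  have hg : g * g = 1 := by
    rw [smul_mul_smul_comm] at hh
    push_cast at hh
    rw [← sq] at hh
    exact smul_right_injective A (pow_ne_zero 2 hrc) hh
  have hxg : x * g = -(g * x) := by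
    rw [mul_smul_comm, smul_mul_assoc, ← smul_neg] at hanti
    exact smul_right_injective A hrc hanti
  have hxgE : x * g ∈ E := by
    have := E.smul_mem (r : ℂ)⁻¹ hxh
    rwa [mul_smul_comm, smul_smul, inv_mul_cancel₀ hrc, one_smul] at this
  -- The spectral projection of h at r. On e and 1 − e the element x*x is m + r and m − r, so r = m
  -- leaves only the first piece.
  set e : A := (1 / 2 : ℂ) • (1 + g) with he
  have he' : 1 - e = (1 / 2 : ℂ) • (1 - g) := by rw [he]; module
  have hge : g = (2 : ℂ) • e - 1 := by rw [he]; module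
  have heP : IsStarProjection e := by
    refine ⟨?_, ?_⟩
    · change e * e = e
      rw [he, smul_mul_smul_comm]
      simp only [add_mul, mul_add, hg, one_mul, mul_one]
      module
    · change star e = e
      rw [he, star_smul, star_add, hgs]
      simp
  have hee : e * e = e := heP.isIdempotentElem
  have hxe : x * e = (1 - e) * x := by
    rw [he', he, mul_smul_comm, smul_mul_assoc, mul_add, sub_mul, hxg, mul_one, one_mul,
      sub_eq_add_neg]
  have hxe' : x * (1 - e) = (1 - (1 - e)) * x := by
    rw [mul_sub, hxe]
    noncomm_ring
  have hxeE : x * e ∈ E := by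
    rw [he, mul_smul_comm, mul_add, mul_one]
    exact E.smul_mem _ (E.add_mem hx hxgE)
  have hxeE' : x * (1 - e) ∈ E := by
    rw [mul_sub, mul_one]
    exact E.sub_mem hx hxeE
  have hne0 : e ≠ 0 := by
    intro h0
    rw [h0] at hxe
    simp only [mul_zero, sub_zero, one_mul] at hxe
    exact hx0 hxe.symm
  have hne1 : e ≠ 1 := by
    intro h0
    rw [h0] at hxe
    simp only [mul_one, sub_self, zero_mul] at hxe
    exact hx0 hxe
  have hpe : star x * x * e = ((m + r : ℝ) : ℂ) • e := by
    rw [hp, hge]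
    simp only [add_mul, sub_mul, smul_mul_assoc, smul_sub, one_mul, hee]
    push_cast
    module
  have hqe : (1 - e) * (x * star x) = ((m + r : ℝ) : ℂ) • (1 - e) := by
    rw [hq, hge]
    simp only [sub_mul, mul_sub, mul_smul_comm, smul_sub, one_mul, mul_one, hee]
    push_cast
    module
  have hpe' : star x * x * (1 - e) = ((m - r : ℝ) : ℂ) • (1 - e) := by
    rw [mul_sub, hpe, hp, hge]
    push_cast
    simp only [mul_one]
    module
  have hqe' : (1 - (1 - e)) * (x * star x) = ((m - r : ℝ) : ℂ) • (1 - (1 - e)) := by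
    rw [sub_sub_cancel, hq, hge]
    simp only [mul_sub, mul_smul_comm, smul_sub, mul_one, hee]
    push_cast
    module
  have hmr : 0 < m + r := by linarith
  obtain ⟨h1, h2⟩ := smul_mul_projection heP hmr hxe hpe hqe
  have hsplit : x = x * e + x * (1 - e) := by rw [← mul_add, add_sub_cancel, mul_one]
  rcases hrm.eq_or_lt with rfl | hlt
  · left
    have h0 : x * (1 - e) = 0 := by
      rw [← CStarRing.star_mul_self_eq_zero_iff, star_mul, mul_assoc, ← mul_assoc (star x), hpe']
      simp
    refine ⟨Real.sqrt (r + r), _, e, E.smul_mem _ hxeE, ?_, ⟨heP, hne0, hne1⟩, h1, h2, ?_⟩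
    · rw [IsPartialIsometry, h1]
      exact heP
    · rw [← hback _ hmr]
      rwa [h0, add_zero] at hsplit
  · right; left
    have hmr' : 0 < m - r := by linarith
    obtain ⟨h3, h4⟩ := smul_mul_projection heP.one_sub hmr' hxe' hpe' hqe'
    rw [sub_sub_cancel] at h4
    refine ⟨Real.sqrt (m + r), Real.sqrt (m - r), _, _, e, hroot _ hmr, hroot _ hmr', ?_,
      E.smul_mem _ hxeE, E.smul_mem _ hxeE', ?_, ?_, ⟨heP, hne0, hne1⟩, h1, h2, h3, h4, ?_⟩
    · intro heq
      have h5 : Real.sqrt (m + r) = Real.sqrt (m - r) := by exact_mod_cast heq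
      rw [Real.sqrt_inj hmr.le hmr'.le] at h5
      linarith
    · rw [IsPartialIsometry, h1]
      exact heP
    · rw [IsPartialIsometry, h3]
      exact heP.one_sub
    · rw [← hback _ hmr, ← hback _ hmr']
      exact hsplit

end Classification

/-! ### Eigenvectors of an ergodic semigroup. -/

section Semigroup

variable {A G : Type*} [CStarAlgebra A] [PartialOrder A]

theorem exists_eq_smul_one_of_fixed {ω : A →ₚ[ℂ] ℂ} (hω1 : ω 1 = 1)
    {Φ : G → (A →ₚ[ℂ] A)} (hΦ : IsErgodicSemigroup Φ) {a : A} (ha : 0 ≤ a)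
    (hfix : ∀ g, Φ g a = a) : ∃ t : ℝ, 0 ≤ t ∧ a = (t : ℂ) • 1 := by
  obtain ⟨c, rfl⟩ := (hΦ a).1 fun g => by rw [hfix, one_smul]
  have h := ω.map_nonneg ha
  rw [map_smul, hω1, smul_eq_mul, mul_one] at h
  exact ⟨c.re, (Complex.le_def.1 h).1, by rw [← Complex.eq_re_of_ofReal_le h]⟩

variable [StarOrderedRing A]

/-- If `x` is mapped to a unimodular multiple, then `x* x + x x*` is a fixed point. -/
theorem map_star_mul_add_of_map_eq_smul {ω : A →ₚ[ℂ] ℂ}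
    (hfaith : ∀ x : A, 0 ≤ x → ω x = 0 → x = 0) {f : A →ₚ[ℂ] A} (hf : f 1 = 1)
    (hinv : ∀ x, ω (f x) = ω x) {c : ℂ} (hc : ‖c‖ = 1) {x : A} (hx : f x = c • x) :
    f (star x * x + x * star x) = star x * x + x * star x ∧
      star (f x) * f x + f x * star (f x) = star x * x + x * star x := by
  have hcc : star c * c = 1 := by
    rw [RCLike.star_def, mul_comm, Complex.mul_conj, Complex.normSq_eq_norm_sq, hc]
    simp
  have hcc' : c * star c = 1 := by rw [mul_comm, hcc]
  have h2 : star (f x) * f x + f x * star (f x) = star x * x + x * star x := by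
    rw [hx, star_smul, smul_mul_smul_comm, smul_mul_smul_comm, hcc, hcc', one_smul, one_smul]
  refine ⟨?_, h2⟩
  have h1 := f.map_star_mul_add_mul_star_le hf x
  rw [h2, ← sub_nonneg] at h1
  exact sub_eq_zero.1 (hfaith _ h1 (by rw [map_sub, hinv, sub_self]))

theorem eigenvector_trichotomy {ω : A →ₚ[ℂ] ℂ} (hω1 : ω 1 = 1)
    (hfaith : ∀ x : A, 0 ≤ x → ω x = 0 → x = 0) {Φ : G → (A →ₚ[ℂ] A)}
    (hone : ∀ g, Φ g 1 = 1) (hinv : IsInvariantUnder ω Φ) (herg : IsErgodicSemigroup Φ)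
    {χ : G → ℂ} (hχ : ∀ g, ‖χ g‖ = 1) {x : A} (hx : x ∈ semigroupEigenspace Φ χ) (hx0 : x ≠ 0) :
    IsPartialIsometryForm (semigroupEigenspace Φ χ) x ∨
      IsTwoPartialIsometriesForm (semigroupEigenspace Φ χ) x ∨
      IsUnitaryForm (semigroupEigenspace Φ χ) x := by
  have hxg : ∀ g, Φ g x = χ g • x := hx
  have hxsg : ∀ g, Φ g (star x) = star (χ g) • star x := fun g => by
    rw [map_star, hxg, star_smul]
  have hχχ : ∀ g, χ g * star (χ g) = 1 := fun g => by
    rw [RCLike.star_def, Complex.mul_conj, Complex.normSq_eq_norm_sq, hχ]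
    simp
  have hcanc : ∀ {y z : A}, (2 : ℂ) • y = (2 : ℂ) • z → y = z := fun h =>
    smul_right_injective A two_ne_zero h
  have hpos : ∀ y : A, 0 ≤ star y * y + y * star y := fun y =>
    add_nonneg (star_mul_self_nonneg y) (mul_star_self_nonneg y)
  have hscal : ∀ {ξ : G → ℂ} {y : A}, (∀ g, ‖ξ g‖ = 1) → (∀ g, Φ g y = ξ g • y) →
      ∃ t : ℝ, 0 ≤ t ∧ star y * y + y * star y = (t : ℂ) • 1 := fun hξ hy =>
    exists_eq_smul_one_of_fixed hω1 herg (hpos _) fun g =>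
      (map_star_mul_add_of_map_eq_smul hfaith (hone g) (hinv g) (hξ g) (hy g)).1
  have hjordan : ∀ g z, Φ g (z * x + x * z) = Φ g z * Φ g x + Φ g x * Φ g z := fun g =>
    (Φ g).map_mul_add_mul_of_map_star_mul_add (hone g) (by
      obtain ⟨h1, h2⟩ :=
        map_star_mul_add_of_map_eq_smul hfaith (hone g) (hinv g) (hχ g) (hxg g)
      rw [h1, h2])
  have hjordan' : ∀ g z, Φ g (z * star x + star x * z) =
      Φ g z * Φ g (star x) + Φ g (star x) * Φ g z := fun g z => by
    have := congrArg star (hjordan g (star z))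
    simpa only [← map_star, star_add, star_mul, star_star, add_comm] using this
  have hxx : ∀ g, Φ g (x * x) = (χ g ^ 2) • (x * x) := fun g => by
    apply hcanc
    rw [← map_smul, two_smul, hjordan, hxg, smul_mul_smul_comm]
    module
  obtain ⟨t, ht0, ht⟩ := hscal hχ hxg
  obtain ⟨d, hd0, hd⟩ := hscal (ξ := fun g => χ g ^ 2) (fun g => by rw [norm_pow, hχ, one_pow]) hxx
  have hq : x * star x = (t : ℂ) • 1 - star x * x := by rw [← ht]; abel
  -- With p = x*x and xx* = t − p, both x*²x² and x²x*² equal tp − p².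
  have hquad : (2 : ℂ) • (star x * x * (star x * x)) = ((2 * t : ℝ) : ℂ) • (star x * x) -
      (d : ℂ) • 1 := by
    rw [← hd, star_mul]
    have e1 : star x * star x * (x * x) =
        (t : ℂ) • (star x * x) - star x * x * (star x * x) := by
      have : star x * x * (star x * x) = star x * (x * star x) * x := by noncomm_ring
      rw [this, hq]
      simp only [mul_sub, sub_mul, mul_smul_comm, smul_mul_assoc, mul_one]
      noncomm_ring
    have e2 : x * x * (star x * star x) =
        (t : ℂ) • (star x * x) - star x * x * (star x * x) := by
      have : x * x * (star x * star x) = x * (x * star x) * star x := by noncomm_ring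
      rw [this, hq]
      have h3 : x * ((t : ℂ) • 1 - star x * x) * star x =
          (t : ℂ) • (x * star x) - x * star x * (x * star x) := by
        simp only [mul_sub, sub_mul, mul_smul_comm, smul_mul_assoc, mul_one]
        noncomm_ring
      rw [h3, hq]
      simp only [mul_sub, sub_mul, mul_smul_comm, smul_mul_assoc, mul_one, one_mul]
      module
    rw [e1, e2]
    push_cast
    module
  set h : A := star x * x - ((t / 2 : ℝ) : ℂ) • 1 with hh
  have hp : star x * x = ((t / 2 : ℝ) : ℂ) • 1 + h := by rw [hh]; abel
  have hq' : x * star x = ((t / 2 : ℝ) : ℂ) • 1 - h := by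
    rw [hq, hh]
    push_cast
    module
  have hhh : h * h = ((t ^ 2 / 4 - d / 2 : ℝ) : ℂ) • 1 := by
    apply hcanc
    have : (2 : ℂ) • (h * h) = (2 : ℂ) • (star x * x * (star x * x)) -
        (2 * t : ℂ) • (star x * x) + (t ^ 2 / 2 : ℂ) • 1 := by
      rw [hh]
      simp only [mul_sub, sub_mul, mul_smul_comm, smul_mul_assoc, mul_one, one_mul]
      push_cast
      module
    rw [this, hquad]
    push_cast
    module
  have hs0 : 0 ≤ t ^ 2 / 4 - d / 2 := by
    have hhs : star h = h := by rw [hh]; simp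
    have h0 : 0 ≤ h * h := by simpa only [hhs] using star_mul_self_nonneg h
    rw [hhh] at h0
    have h1 := ω.map_nonneg h0
    rw [map_smul, hω1, smul_eq_mul, mul_one] at h1
    exact_mod_cast h1
  -- The Jordan product of x² and x* has eigenvalue χ² times the conjugate of χ, which is χ by
  -- unimodularity.
  have htriple : x * (star x * x) ∈ semigroupEigenspace Φ χ := by
    have e : x * (star x * x) = (t : ℂ) • x -
        (1 / 2 : ℂ) • (x * x * star x + star x * (x * x)) := by
      have e1 : x * x * star x = (t : ℂ) • x - x * (star x * x) := by
        rw [mul_assoc, hq, mul_sub, mul_smul_comm, mul_one]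
      have e2 : star x * (x * x) = (t : ℂ) • x - x * (star x * x) := by
        rw [← mul_assoc, ← mul_assoc, hq, sub_mul, smul_mul_assoc, one_mul]
        abel
      rw [e1, e2]
      module
    rw [e]
    refine Submodule.sub_mem _ (Submodule.smul_mem _ _ hx) (Submodule.smul_mem _ _ fun g => ?_)
    rw [hjordan', hxx, hxsg, smul_mul_smul_comm, smul_mul_smul_comm, mul_comm (star (χ g)),
      sq, mul_assoc, hχχ, mul_one, smul_add]
  have hxh : x * h ∈ semigroupEigenspace Φ χ := by
    rw [hh, mul_sub, mul_smul_comm, mul_one]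
    exact Submodule.sub_mem _ htriple (Submodule.smul_mem _ _ hx)
  refine trichotomy_of_sq_eq (r := Real.sqrt (t ^ 2 / 4 - d / 2)) hx hxh hx0 (Real.sqrt_nonneg _)
    ?_ hp hq' ?_
  -- The bound r ≤ t/2 is d ≥ 0.
  · rw [Real.sqrt_le_left (by positivity)]
    linarith
  · rw [Real.sq_sqrt hs0, hhh]

end Semigroup

/-! ### Von Neumann algebras as ordered C*-algebras. -/

namespace VonNeumannAlgebra

variable {H : Type*} [NormedAddCommGroup H] [InnerProductSpace ℂ H] [CompleteSpace H]

theorem isClosed_toStarSubalgebra (M : VonNeumannAlgebra H) :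
    IsClosed (M.toStarSubalgebra : Set (H →L[ℂ] H)) := by
  rw [coe_toStarSubalgebra, ← centralizer_centralizer]
  exact Set.isClosed_centralizer _

/-- The order is inherited from operators on H; a positive element of M has its square root in M,
because M is norm closed and so stable under continuous functional calculus. -/
theorem starOrderedRing_toStarSubalgebra (M : VonNeumannAlgebra H) :
    StarOrderedRing M.toStarSubalgebra := by
  refine StarOrderedRing.of_nonneg_iff' (fun h z => add_le_add_right (α := H →L[ℂ] H) h z)
    fun x => ⟨fun hx => ?_, ?_⟩
  · have hx' : (0 : H →L[ℂ] H) ≤ x := hx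
    have hmem : CFC.sqrt (x : H →L[ℂ] H) ∈ M.toStarSubalgebra := by
      rw [CFC.sqrt_eq_cfc, cfc_nnreal_eq_real _ _ hx']
      have := M.isClosed_toStarSubalgebra
      exact cfc_mem (𝕜' := ℂ) _ x.2
    refine ⟨⟨CFC.sqrt (x : H →L[ℂ] H), hmem⟩, Subtype.ext ?_⟩
    change (x : H →L[ℂ] H) = star (CFC.sqrt (x : H →L[ℂ] H)) * CFC.sqrt (x : H →L[ℂ] H)
    rw [(IsSelfAdjoint.of_nonneg (CFC.sqrt_nonneg _)).star_eq, CFC.sqrt_mul_sqrt_self _ hx']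
  · rintro ⟨s, rfl⟩
    exact star_mul_self_nonneg (s : H →L[ℂ] H)

end VonNeumannAlgebra

theorem norm_unimodularPower (θ : ℝ) (t : ℝ≥0) : ‖unimodularPower θ t‖ = 1 := by
  have : Complex.I * (θ : ℂ) * ((t : ℝ) : ℂ) = ((θ * t : ℝ) : ℂ) * Complex.I := by
    push_cast
    ring
  rw [unimodularPower, this, Complex.norm_exp_ofReal_mul_I]

theorem mainTheorem1 {H : Type*} [NormedAddCommGroup H] [InnerProductSpace ℂ H] [CompleteSpace H]
    (M : VonNeumannAlgebra H)
    (ω : M.toStarSubalgebra →ₚ[ℂ] ℂ) (hω : IsFaithfulNormalState ω) :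
    (∀ Φ : ℕ → (M.toStarSubalgebra →ₚ[ℂ] M.toStarSubalgebra),
      IsNormalUnitalSemigroup Φ → IsInvariantUnder ω Φ → IsErgodicSemigroup Φ →
      ∀ lam : ℂ, ‖lam‖ = 1 →
      ∀ x ∈ semigroupEigenspace Φ (fun n => lam ^ n), x ≠ 0 →
        IsPartialIsometryForm (semigroupEigenspace Φ (fun n => lam ^ n)) x ∨
        IsTwoPartialIsometriesForm (semigroupEigenspace Φ (fun n => lam ^ n)) x ∨
        IsUnitaryForm (semigroupEigenspace Φ (fun n => lam ^ n)) x) ∧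
    (∀ Φ : ℝ≥0 → (M.toStarSubalgebra →ₚ[ℂ] M.toStarSubalgebra),
      IsNormalUnitalSemigroup Φ → IsInvariantUnder ω Φ → IsErgodicSemigroup Φ →
      ∀ θ : ℝ,
      ∀ x ∈ semigroupEigenspace Φ (unimodularPower θ), x ≠ 0 →
        IsPartialIsometryForm (semigroupEigenspace Φ (unimodularPower θ)) x ∨
        IsTwoPartialIsometriesForm (semigroupEigenspace Φ (unimodularPower θ)) x ∨
        IsUnitaryForm (semigroupEigenspace Φ (unimodularPower θ)) x) := by
  have := M.isClosed_toStarSubalgebra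
  have := M.starOrderedRing_toStarSubalgebra
  refine ⟨fun Φ hΦ hinv herg lam hlam x hx hx0 => ?_, fun Φ hΦ hinv herg θ x hx hx0 => ?_⟩
  · exact eigenvector_trichotomy hω.map_one hω.faithful hΦ.map_one hinv herg
      (fun n => by rw [norm_pow, hlam, one_pow]) hx hx0
  · exact eigenvector_trichotomy hω.map_one hω.faithful hΦ.map_one hinv herg
      (norm_unimodularPower θ) hx hx0
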